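/- Let $\mathcal{T}\subset\mathbb{R}^m$ be compact, let $X_1,X_2,\dots$ be i.i.d. random variables with values in a measurable space $\mathcal{X}$, and let $\hat\theta\colon\mathcal{X}\times\mathcal{T}\to\mathbb{R}$ be such that $\hat\theta(\cdot,t)$ is measurable for every $t\in\mathcal{T}$, $\hat\theta(x,\cdot)$ is continuous for every $x\in\mathcal{X}$, and $\hat\theta(X_1,t)$ has finite variance and expectation $\theta(t)$ for every $t\in\mathcal{T}$. Assume that $\theta$ attains its minimum $\theta_*=\min_{t\in\mathcal{T}}\theta(t)$, and let $\mathcal{T}'$ be a countable dense subset of $\mathcal{T}$. For $n\ge 1$ put $$\hat\theta_n(X,t)=\frac1n\sum_{i=1}^n\hat\theta(X_i,t),\qquad \hat\theta_{*n}(X)=\min_{t\in\mathcal{T}}\hat\theta_n(X,t),\qquad Z_n(t)=\hat\theta_n(X,t)-\theta(t),$$ $$d_n(s,t)=\sqrt{E\big((Z_n(s)-Z_n(t))^2\big)},\qquad \sigma_1=\Big(\inf_{t\in\mathcal{T}'}\mathrm{Var}(Z_1(t))\Big)^{1/2}.$$ Call $\hat\theta_n(X,t)$ sub-Gaussian if for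 all $s,t\in\mathcal{T}$ and all $u>0$ $$P\big(|Z_n(s)-Z_n(t)|\ge u\big)\le 2\exp\Big(-\frac{u^2}{2d_n(s,t)^2}\Big)$$ (a condition that holds automatically when $d_n(s,t)=0$). Let $$\gamma_2(\mathcal{T}',d_1)=\inf_{(\mathcal{A}_k)}\ \sup_{t\in\mathcal{T}'}\ \sum_{k=0}^\infty 2^{k/2}\,\Delta_1(A_k(t)),\qquad \Delta_1(A)=\sup_{s,t\in A}d_1(s,t),$$ where the infimum is over all sequences $(\mathcal{A}_k)_{k\ge0}$ of partitions of $\mathcal{T}'$ such that $\mathcal{A}_{k+1}$ refines $\mathcal{A}_k$, $|\mathcal{A}_0|=1$ and $|\mathcal{A}_k|\le 2^{2^k}$ for $k\ge1$, and where $A_k(t)$ is the element of $\mathcal{A}_k$ that contains $t$. If $\hat\theta_n(X,t)$ is sub-Gaussian for every $n\ge1$, $\sigma_1<\infty$ and $\gamma_2(\mathcal{T}',d_1)<\infty$, then $\hat\theta_{*n}(X)$ is a consistent estimator of $\theta_*$: for every $\epsilon>0$, $$\lim_{n\to\infty}P\big(|\hat\theta_{*n}(X)-\theta_*|>\epsilon\big)=0.$$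 -/

import Mathlib

open MeasureTheory ProbabilityTheory Filter Topology
open scoped ENNReal

namespace ImpreciseEstimation

noncomputable section

/-- A sequence of estimators `Z n` is consistent for the number `z`:
for all `ε > 0`, `P(|Z n - z| > ε) → 0` as `n → ∞`. -/
def IsConsistent {Ω : Type*} [MeasurableSpace Ω] (P : Measure Ω) (Z : ℕ → Ω → ℝ) (z : ℝ) : Prop :=
  ∀ ε : ℝ, 0 < ε → Tendsto (fun n => P {ω | ε < |Z n ω - z|}) atTop (𝓝 0)

/-- The sample-mean estimator `θ̂_n(X, t) = (1/n) ∑_{i=1}^n θ̂(X_i, t)`; the sample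
`X_1, X_2, …` is indexed here as `X 0, X 1, …`. -/
def sampleMean {Ω 𝒳 T : Type*} (θhat : 𝒳 → T → ℝ) (X : ℕ → Ω → 𝒳) (n : ℕ) (t : T) (ω : Ω) : ℝ :=
  (1 / (n : ℝ)) * ∑ i ∈ Finset.range n, θhat (X i ω) t

/-- The lower envelope `θ̂_{*n}(X) = min_{t ∈ T} θ̂_n(X, t)`. On a nonempty compact `T`, with `θ̂`
continuous in `t`, the infimum is attained: see `isLeast_lowerEnvelope`. -/
def lowerEnvelope {Ω 𝒳 T : Type*} (θhat : 𝒳 → T → ℝ) (X : ℕ → Ω → 𝒳) (n : ℕ) (ω : Ω) : ℝ :=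
  ⨅ t : T, sampleMean θhat X n t ω

theorem isLeast_lowerEnvelope {Ω 𝒳 T : Type*} [TopologicalSpace T] [CompactSpace T] [Nonempty T]
    (θhat : 𝒳 → T → ℝ) (hcont : ∀ x, Continuous (θhat x)) (X : ℕ → Ω → 𝒳) (n : ℕ) (ω : Ω) :
    IsLeast (Set.range fun t => sampleMean θhat X n t ω) (lowerEnvelope θhat X n ω) := by
  have hc : Continuous fun t => sampleMean θhat X n t ω := by
    unfold sampleMean
    exact continuous_const.mul (continuous_finsetSum _ fun i _ => hcont (X i ω))
  exact (isCompact_range hc).isLeast_sInf (Set.range_nonempty _)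

/-- The centred process `Z_n(t) = θ̂_n(X, t) - θ(t)`. -/
def centred {Ω 𝒳 T : Type*} (θhat : 𝒳 → T → ℝ) (X : ℕ → Ω → 𝒳) (θ : T → ℝ)
    (n : ℕ) (t : T) (ω : Ω) : ℝ :=
  sampleMean θhat X n t ω - θ t

/-- The canonical pseudo-metric `d(s, t) = √E((Z(s) - Z(t))²)` of a process `Z`. -/
def canonicalDist {Ω T : Type*} [MeasurableSpace Ω] (P : Measure Ω) (Z : T → Ω → ℝ) (s t : T) : ℝ :=
  √(∫ ω, (Z s ω - Z t ω) ^ 2 ∂P)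

/-- The increment condition defining a sub-Gaussian process `Z`:
`P(|Z(s) - Z(t)| ≥ u) ≤ 2 exp(-u² / (2 d(s,t)²))` for all `s`, `t` and all `u > 0`, where `d` is
the canonical pseudo-metric of `Z`. If `d(s,t) = 0` then, for square integrable `Z`,
`Z(s) = Z(t)` almost surely and the left-hand side is `0`, so that the value that the right-hand
side takes under the convention `x / 0 = 0` is immaterial. -/
def IsSubGaussian {Ω T : Type*} [MeasurableSpace Ω] (P : Measure Ω) (Z : T → Ω → ℝ) : Prop :=
  ∀ s t : T, ∀ u : ℝ, 0 < u →
    P.real {ω | u ≤ |Z s ω - Z t ω|} ≤ 2 * Real.exp (-(u ^ 2 / (2 * canonicalDist P Z s t ^ 2)))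

/-- An admissible sequence of partitions of `S`. A partition is given by its equivalence
relation, whose classes are its cells. An increasing sequence of partitions is one in which each
cell of a later partition lies in a cell of every earlier one, that is, the equivalence relations
decrease. -/
structure IsAdmissible {S : Type*} (𝒜 : ℕ → Setoid S) : Prop where
  refines : Antitone 𝒜
  card_zero : (𝒜 0).classes.encard = 1
  card_le : ∀ k : ℕ, 1 ≤ k → (𝒜 k).classes.encard ≤ 2 ^ (2 ^ k)

/-- The cell `A_k(t)` of the partition `𝒜 k` that contains `t`. -/
def cell {S : Type*} (𝒜 : ℕ → Setoid S) (k : ℕ) (t : S) : Set S := {s | 𝒜 k s t}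

/-- The diameter `Δ(A) = sup_{s, t ∈ A} d(s, t)`, possibly infinite. -/
def diameter {S : Type*} (d : S → S → ℝ) (A : Set S) : ℝ≥0∞ :=
  ⨆ s ∈ A, ⨆ t ∈ A, ENNReal.ofReal (d s t)

/-- The Talagrand functional
`γ_α(T', d) = inf_𝒜 sup_{t ∈ T'} ∑_{k ≥ 0} 2^{k/α} Δ(A_k(t))`, the infimum being over all
admissible sequences of partitions of `T'`; it takes values in `[0, ∞]`. -/
def talagrand {T : Type*} (α : ℝ) (T' : Set T) (d : T → T → ℝ) : ℝ≥0∞ :=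
  ⨅ (𝒜 : ℕ → Setoid T') (_ : IsAdmissible 𝒜),
    ⨆ t : T', ∑' k : ℕ, (2 : ℝ≥0∞) ^ ((k : ℝ) / α) * diameter (fun s t : T' => d s t) (cell 𝒜 k t)

/-- The minimal standard deviation `σ = (inf_{t ∈ T'} Var(Z(t)))^{1/2}`, in `[0, ∞]`. -/
def minStdDev {Ω T : Type*} [MeasurableSpace Ω] (P : Measure Ω) (T' : Set T) (Z : T → Ω → ℝ) :
    ℝ≥0∞ :=
  (⨅ t ∈ T', evariance (Z t) P) ^ (1 / 2 : ℝ)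

end

end ImpreciseEstimation

open ImpreciseEstimation

namespace ImpreciseEstimation

/-! The heart is a uniform weak law on `T'`: `sup |Z_n|` tends to 0 in probability. By independence
`d_n = d_1 / √n`, so measured in the fixed metric `d_1` the increments of `Z_n` have tails `2 exp(-n
u² / 2)`. Generic chaining along one admissible sequence with finite `d_1`-sum at most `γ`
(`measure_chaining_le`) keeps all of `Z_n` within `2uγ` of its value at a root, outside probability
`16 exp(-n u² / 2)`. With `u` fixed this vanishes as `n` grows, and Chebyshev's inequality handles
the root.

The two sides of the conclusion differ. From below, `θ̂_n ≥ θ_* - ε/2` on `T'` passes to all of `T`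
by density and continuity of `θ̂_n`; continuity of `θ` is never needed. From above, the minimum is
at most the value at a minimiser of `θ`, possibly outside `T'`, where Chebyshev applies again. -/

/-! ### Admissible partitions and cell representatives. -/

theorem two_rpow_half_eq_ofReal (k : ℕ) :
    (2 : ℝ≥0∞) ^ ((k : ℝ) / 2) = ENNReal.ofReal (√2 ^ k) := by
  have h : (2 : ℝ≥0∞) = ENNReal.ofReal 2 := by simp
  rw [h, ENNReal.ofReal_rpow_of_pos two_pos, Real.sqrt_eq_rpow, ← Real.rpow_natCast,
    ← Real.rpow_mul zero_le_two]
  congr 2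
  ring

/-- A representative of the class of `t` under `r`. -/
noncomputable def classRep {S : Type*} (r : Setoid S) (t : S) : S := (Quotient.mk r t).out

theorem classRep_rel {S : Type*} (r : Setoid S) (t : S) : r (classRep r t) t :=
  Quotient.mk_out (s := r) t

theorem classRep_eq_of_rel {S : Type*} {r : Setoid S} {s t : S} (h : r s t) :
    classRep r s = classRep r t := by
  unfold classRep
  rw [Quotient.sound (s := r) h]

theorem ofReal_le_diameter {S : Type*} (d : S → S → ℝ) {A : Set S} {s t : S} (hs : s ∈ A)
    (ht : t ∈ A) : ENNReal.ofReal (d s t) ≤ diameter d A :=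
  le_iSup₂_of_le s hs (le_iSup₂_of_le t ht le_rfl)

theorem IsAdmissible.card_quotient_le {S : Type*} {𝒜 : ℕ → Setoid S} (h : IsAdmissible 𝒜)
    (k : ℕ) : (ENat.card (Quotient (𝒜 (k + 1))) : ℝ≥0∞) ≤ 4 ^ 2 ^ k := by
  have h1 : ENat.card (Quotient (𝒜 (k + 1))) ≤ 2 ^ 2 ^ (k + 1) := by
    rw [ENat.card_congr (Setoid.quotientEquivClasses (𝒜 (k + 1)))]
    exact h.card_le (k + 1) (Nat.le_add_left 1 k)
  calc (ENat.card (Quotient (𝒜 (k + 1))) : ℝ≥0∞)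
      ≤ ((2 ^ 2 ^ (k + 1) : ℕ∞) : ℝ≥0∞) := ENat.toENNReal_le.2 h1
    _ = 2 ^ 2 ^ (k + 1) := by simp
    _ = 4 ^ 2 ^ k := by rw [pow_succ', pow_mul]; norm_num

theorem IsAdmissible.classRep_zero {S : Type*} {𝒜 : ℕ → Setoid S} (h : IsAdmissible 𝒜)
    (s t : S) : classRep (𝒜 0) s = classRep (𝒜 0) t := by
  apply classRep_eq_of_rel
  obtain ⟨c, hc⟩ := Set.encard_eq_one.1 h.card_zero
  have hmem (x : S) : {y | 𝒜 0 y x} = c := by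
    have : {y | 𝒜 0 y x} ∈ (𝒜 0).classes := (𝒜 0).mem_classes x
    simpa [hc] using this
  have hs : s ∈ {y | 𝒜 0 y s} := (𝒜 0).refl s
  rw [hmem s, ← hmem t] at hs
  exact hs

/-! ### Generic chaining. -/

/-- The event that some link of the chain of representatives exceeds its allowance. -/
def badLinks {Ω S : Type*} (Z : S → Ω → ℝ) (d : S → S → ℝ) (𝒜 : ℕ → Setoid S) (u : ℝ) : Set Ω :=
  ⋃ k : ℕ, ⋃ q : Quotient (𝒜 (k + 1)),
    {ω | u * √2 ^ k * d q.out (classRep (𝒜 k) q.out)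
      < |Z q.out ω - Z (classRep (𝒜 k) q.out) ω|}

/-- A union bound: level `k` has one link per cell of level `k + 1`, hence at most `4 ^ 2 ^ k`, and
each fails with probability at most `2 exp(-c u² 2 ^ k)`. The product is `2 r ^ 2 ^ k`. -/
theorem measure_badLinks_le {Ω S : Type*} [MeasurableSpace Ω] {P : Measure Ω} [Countable S]
    {Z : S → Ω → ℝ} {d : S → S → ℝ} {c : ℝ}
    (htail : ∀ s t : S, ∀ u : ℝ, 0 < u →
      P {ω | u * d s t < |Z s ω - Z t ω|} ≤ ENNReal.ofReal (2 * Real.exp (-(c * u ^ 2))))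
    {𝒜 : ℕ → Setoid S} (h𝒜 : IsAdmissible 𝒜) {u : ℝ} (hu : 0 < u)
    (hr : 4 * Real.exp (-(c * u ^ 2)) ≤ 1 / 2) :
    P (badLinks Z d 𝒜 u) ≤ ENNReal.ofReal (16 * Real.exp (-(c * u ^ 2))) := by
  set r := 4 * Real.exp (-(c * u ^ 2)) with hrdef
  have hr0 : 0 ≤ r := by positivity
  have hlink (k : ℕ) : P (⋃ q : Quotient (𝒜 (k + 1)),
      {ω | u * √2 ^ k * d q.out (classRep (𝒜 k) q.out)
        < |Z q.out ω - Z (classRep (𝒜 k) q.out) ω|}) ≤ ENNReal.ofReal (2 * r * (1 / 2) ^ k) := by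
    have hv : 0 < u * √2 ^ k := by positivity
    have hexp : Real.exp (-(c * (u * √2 ^ k) ^ 2)) = Real.exp (-(c * u ^ 2)) ^ 2 ^ k := by
      rw [← Real.exp_nat_mul, mul_pow, ← pow_mul, mul_comm k 2, pow_mul, Real.sq_sqrt zero_le_two]
      congr 1
      push_cast
      ring
    calc _ ≤ ∑' q : Quotient (𝒜 (k + 1)), P {ω | u * √2 ^ k * d q.out (classRep (𝒜 k) q.out)
          < |Z q.out ω - Z (classRep (𝒜 k) q.out) ω|} := measure_iUnion_le _
      _ ≤ ∑' _ : Quotient (𝒜 (k + 1)), ENNReal.ofReal (2 * Real.exp (-(c * u ^ 2)) ^ 2 ^ k) :=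
          ENNReal.tsum_le_tsum fun q => by
            rw [← hexp]
            exact htail _ _ _ hv
      _ ≤ 4 ^ 2 ^ k * ENNReal.ofReal (2 * Real.exp (-(c * u ^ 2)) ^ 2 ^ k) := by
          rw [ENNReal.tsum_const]
          gcongr
          exact h𝒜.card_quotient_le k
      _ = ENNReal.ofReal (2 * r ^ 2 ^ k) := by
          have h4 : (4 : ℝ≥0∞) = ENNReal.ofReal 4 := by simp
          rw [h4, ← ENNReal.ofReal_pow (by norm_num), ← ENNReal.ofReal_mul (by positivity), hrdef,
            mul_pow]
          congr 1
          ring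
      _ ≤ ENNReal.ofReal (2 * r * (1 / 2) ^ k) := by
          apply ENNReal.ofReal_le_ofReal
          -- As `r ≤ 1/2` and `k + 1 ≤ 2 ^ k`, the doubly exponential bound is at most a geometric
          -- one.
          have h1 : r ^ 2 ^ k ≤ r ^ (k + 1) :=
            pow_le_pow_of_le_one hr0 (by linarith) Nat.lt_two_pow_self
          have h2 : r ^ k ≤ (1 / 2) ^ k := pow_le_pow_left₀ hr0 hr k
          have h3 : r ^ (k + 1) ≤ r * (1 / 2) ^ k := by
            rw [pow_succ']
            exact mul_le_mul_of_nonneg_left h2 hr0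
          linarith
  have hgeom := (hasSum_geometric_of_lt_one (r := (1 / 2 : ℝ)) (by norm_num)
    (by norm_num)).mul_left (2 * r)
  calc P (badLinks Z d 𝒜 u) ≤ ∑' k : ℕ, ENNReal.ofReal (2 * r * (1 / 2) ^ k) :=
        (measure_iUnion_le _).trans (ENNReal.tsum_le_tsum hlink)
    _ = ENNReal.ofReal (16 * Real.exp (-(c * u ^ 2))) := by
        rw [← ENNReal.ofReal_tsum_of_nonneg (fun k => by positivity) hgeom.summable, hgeom.tsum_eq,
          hrdef]
        congr 1
        ring

/-- Telescoping: by refinement, the level-`K` representative of the level-`K + 1` representative of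
`t` is that of `t` itself, so consecutive representatives are joined by links. -/
theorem abs_sub_classRep_le_of_notMem_badLinks {Ω S : Type*} {Z : S → Ω → ℝ} {d : S → S → ℝ}
    {𝒜 : ℕ → Setoid S} (h𝒜 : IsAdmissible 𝒜) {u : ℝ} {ω : Ω} (hω : ω ∉ badLinks Z d 𝒜 u)
    (t : S) (K : ℕ) :
    |Z (classRep (𝒜 K) t) ω - Z (classRep (𝒜 0) t) ω| ≤
      u * ∑ k ∈ Finset.range K, √2 ^ k * d (classRep (𝒜 (k + 1)) t) (classRep (𝒜 k) t) := by
  induction K with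
  | zero => simp
  | succ K ih =>
    rw [Finset.sum_range_succ, mul_add]
    have hlink : |Z (classRep (𝒜 (K + 1)) t) ω - Z (classRep (𝒜 K) t) ω| ≤
        u * √2 ^ K * d (classRep (𝒜 (K + 1)) t) (classRep (𝒜 K) t) := by
      simp only [badLinks, Set.mem_iUnion, Set.mem_ofPred_eq, not_exists, not_lt] at hω
      have hrep : classRep (𝒜 K) (classRep (𝒜 (K + 1)) t) = classRep (𝒜 K) t :=
        classRep_eq_of_rel (h𝒜.refines K.le_succ (classRep_rel (𝒜 (K + 1)) t))
      have := hω K (Quotient.mk _ t)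
      change |Z (classRep (𝒜 (K + 1)) t) ω - Z (classRep (𝒜 K) (classRep (𝒜 (K + 1)) t)) ω| ≤
        u * √2 ^ K * d (classRep (𝒜 (K + 1)) t)
          (classRep (𝒜 K) (classRep (𝒜 (K + 1)) t)) at this
      rwa [hrep] at this
    have := abs_sub_le (Z (classRep (𝒜 (K + 1)) t) ω) (Z (classRep (𝒜 K) t) ω)
      (Z (classRep (𝒜 0) t) ω)
    linarith

/-- **Generic chaining.** A process indexed by a countable set, with increments that are
sub-Gaussian with respect to `d`, stays close to its value at the root of the chain. -/
theorem measure_chaining_le {Ω S : Type*} [MeasurableSpace Ω] {P : Measure Ω} [Countable S]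
    {Z : S → Ω → ℝ} {d : S → S → ℝ} (hd : ∀ s t, 0 ≤ d s t) {c : ℝ}
    (htail : ∀ s t : S, ∀ u : ℝ, 0 < u →
      P {ω | u * d s t < |Z s ω - Z t ω|} ≤ ENNReal.ofReal (2 * Real.exp (-(c * u ^ 2))))
    {𝒜 : ℕ → Setoid S} (h𝒜 : IsAdmissible 𝒜) {γ : ℝ} (hγ0 : 0 ≤ γ)
    (hγ : ∀ t, ∑' k : ℕ, (2 : ℝ≥0∞) ^ ((k : ℝ) / 2) * diameter d (cell 𝒜 k t) ≤ ENNReal.ofReal γ)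
    {u : ℝ} (hu : 0 < u) (hr : 4 * Real.exp (-(c * u ^ 2)) ≤ 1 / 2) (t₀ : S) :
    P {ω | ∃ t, 2 * (u * γ) < |Z t ω - Z (classRep (𝒜 0) t₀) ω|} ≤
      ENNReal.ofReal (16 * Real.exp (-(c * u ^ 2))) := by
  have hpartial (t : S) (K : ℕ) (x y : ℕ → S) (hx : ∀ k, x k ∈ cell 𝒜 k t)
      (hy : ∀ k, y k ∈ cell 𝒜 k t) : ∑ k ∈ Finset.range K, √2 ^ k * d (x k) (y k) ≤ γ := by
    rw [← ENNReal.ofReal_le_ofReal_iff hγ0,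
      ENNReal.ofReal_sum_of_nonneg fun k _ => mul_nonneg (by positivity) (hd _ _)]
    refine le_trans ?_ ((ENNReal.sum_le_tsum (Finset.range K)).trans (hγ t))
    refine Finset.sum_le_sum fun k _ => ?_
    rw [two_rpow_half_eq_ofReal, ENNReal.ofReal_mul (by positivity)]
    gcongr
    exact ofReal_le_diameter d (hx k) (hy k)
  -- The sign of `c` is not assumed; the smallness condition `hr` forces it.
  have hexp_pos : 0 < c * u ^ 2 := by
    by_contra! h
    have := Real.one_le_exp (x := -(c * u ^ 2)) (by linarith)
    linarith
  -- The chain need not reach `t`: off the bad links, a large deviation at `t` forces the last jump,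
  -- from level `K` to `t`, to be too long. This has probability tending to 0 in `K`, so the event
  -- is null. The chain and the last jump each cost `u * γ`, whence the factor 2.
  have hnull (t : S) : P ({ω | 2 * (u * γ) < |Z t ω - Z (classRep (𝒜 0) t) ω|} \
      badLinks Z d 𝒜 u) = 0 := by
    have hle (K : ℕ) : P ({ω | 2 * (u * γ) < |Z t ω - Z (classRep (𝒜 0) t) ω|} \
        badLinks Z d 𝒜 u) ≤ ENNReal.ofReal (2 * Real.exp (-(c * u ^ 2)) ^ K) := by
      have hsub : {ω | 2 * (u * γ) < |Z t ω - Z (classRep (𝒜 0) t) ω|} \ badLinks Z d 𝒜 u ⊆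
          {ω | u * √2 ^ K * d (classRep (𝒜 K) t) t < |Z (classRep (𝒜 K) t) ω - Z t ω|} := by
        rintro ω ⟨hω, hgood⟩
        simp only [Set.mem_ofPred_eq] at hω ⊢
        have h1 := abs_sub_classRep_le_of_notMem_badLinks h𝒜 hgood t K
        have h2 := hpartial t K (fun k => classRep (𝒜 (k + 1)) t) (fun k => classRep (𝒜 k) t)
          (fun k => h𝒜.refines k.le_succ (classRep_rel (𝒜 (k + 1)) t))
          (fun k => classRep_rel (𝒜 k) t)
        have h3 : √2 ^ K * d (classRep (𝒜 K) t) t ≤ γ := by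
          refine le_trans ?_ (hpartial t (K + 1) (fun k => classRep (𝒜 k) t) (fun _ => t)
            (fun k => classRep_rel (𝒜 k) t) (fun k => (𝒜 k).refl t))
          exact Finset.single_le_sum (f := fun k => √2 ^ k * d (classRep (𝒜 k) t) t)
            (fun k _ => mul_nonneg (by positivity) (hd _ _)) (Finset.self_mem_range_succ K)
        have h4 := mul_le_mul_of_nonneg_left h2 hu.le
        have h5 := mul_le_mul_of_nonneg_left h3 hu.le
        have h6 := abs_sub_le (Z t ω) (Z (classRep (𝒜 K) t) ω) (Z (classRep (𝒜 0) t) ω)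
        rw [abs_sub_comm (Z t ω) (Z (classRep (𝒜 K) t) ω)] at h6
        rw [mul_assoc]
        linarith
      refine (measure_mono hsub).trans ((htail _ _ _ (by positivity)).trans ?_)
      apply ENNReal.ofReal_le_ofReal
      rw [← Real.exp_nat_mul, mul_pow, ← pow_mul, mul_comm K 2, pow_mul, Real.sq_sqrt zero_le_two]
      have hK : (K : ℝ) ≤ 2 ^ K := by exact_mod_cast Nat.lt_two_pow_self.le
      gcongr
      nlinarith
    have hlim : Tendsto (fun K : ℕ => ENNReal.ofReal (2 * Real.exp (-(c * u ^ 2)) ^ K)) atTop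
        (𝓝 0) := by
      have := (tendsto_pow_atTop_nhds_zero_of_lt_one (Real.exp_pos _).le
        (Real.exp_lt_one_iff.2 (neg_lt_zero.2 hexp_pos))).const_mul 2
      simpa using ENNReal.tendsto_ofReal this
    exact le_antisymm (ge_of_tendsto' hlim hle) bot_le
  have hcover : {ω | ∃ t, 2 * (u * γ) < |Z t ω - Z (classRep (𝒜 0) t₀) ω|} ⊆
      badLinks Z d 𝒜 u ∪ ⋃ t, ({ω | 2 * (u * γ) < |Z t ω - Z (classRep (𝒜 0) t) ω|} \
        badLinks Z d 𝒜 u) := by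
    rintro ω ⟨t, ht⟩
    by_cases hb : ω ∈ badLinks Z d 𝒜 u
    · exact Or.inl hb
    · refine Or.inr (Set.mem_iUnion.2 ⟨t, ?_, hb⟩)
      rwa [Set.mem_ofPred_eq, h𝒜.classRep_zero t t₀]
  refine (measure_mono hcover).trans ((measure_union_le _ _).trans ?_)
  rw [measure_iUnion_null hnull, add_zero]
  exact measure_badLinks_le htail h𝒜 hu hr

/-! ### Moments and increments of the sample mean. -/

theorem centred_sub_centred {Ω 𝒳 T : Type*} {X : ℕ → Ω → 𝒳} {θhat : 𝒳 → T → ℝ} {θ : T → ℝ}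
    (n : ℕ) (s t : T) (ω : Ω) :
    centred θhat X θ n s ω - centred θhat X θ n t ω =
      1 / (n : ℝ) * ∑ i ∈ Finset.range n, (θhat (X i ω) s - θhat (X i ω) t) - (θ s - θ t) := by
  simp only [centred, sampleMean, Finset.sum_sub_distrib]
  ring

section SampleMean

variable {Ω 𝒳 T : Type*} [MeasurableSpace Ω] {P : Measure Ω}
  [MeasurableSpace 𝒳] {X : ℕ → Ω → 𝒳}

theorem memLp_comp_sample (hident : ∀ i, IdentDistrib (X i) (X 0) P P) {g : 𝒳 → ℝ}
    (hg : Measurable g) (hL2 : MemLp (fun ω => g (X 0 ω)) 2 P) (i : ℕ) :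
    MemLp (fun ω => g (X i ω)) 2 P :=
  ((hident i).comp hg).symm.memLp_snd hL2

theorem memLp_mean (hident : ∀ i, IdentDistrib (X i) (X 0) P P) {g : 𝒳 → ℝ} (hg : Measurable g)
    (hL2 : MemLp (fun ω => g (X 0 ω)) 2 P) (n : ℕ) :
    MemLp (fun ω => 1 / (n : ℝ) * ∑ i ∈ Finset.range n, g (X i ω)) 2 P :=
  (memLp_finsetSum _ fun i _ => memLp_comp_sample hident hg hL2 i).const_mul _

theorem variance_mean (hindep : iIndepFun X P) (hident : ∀ i, IdentDistrib (X i) (X 0) P P)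
    {g : 𝒳 → ℝ} (hg : Measurable g) (hL2 : MemLp (fun ω => g (X 0 ω)) 2 P) {n : ℕ} (hn : 1 ≤ n) :
    Var[fun ω => 1 / (n : ℝ) * ∑ i ∈ Finset.range n, g (X i ω); P] =
      Var[fun ω => g (X 0 ω); P] / n := by
  have hi (i : ℕ) : Var[fun ω => g (X i ω); P] = Var[fun ω => g (X 0 ω); P] :=
    ((hident i).comp hg).variance_eq
  have hsum := IndepFun.variance_sum (μ := P) (s := Finset.range n)
    (X := fun i ω => g (X i ω)) (fun i _ => memLp_comp_sample hident hg hL2 i)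
    (fun i _ j _ hij => (hindep.comp (fun _ => g) fun _ => hg).indepFun hij)
  have hfun : (∑ i ∈ Finset.range n, fun ω => g (X i ω)) =
      fun ω => ∑ i ∈ Finset.range n, g (X i ω) := by
    ext ω
    simp
  rw [hfun] at hsum
  rw [variance_const_mul, hsum]
  simp only [hi, Finset.sum_const, Finset.card_range, nsmul_eq_mul]
  field_simp

variable [IsProbabilityMeasure P]

theorem integral_mean (hident : ∀ i, IdentDistrib (X i) (X 0) P P) {g : 𝒳 → ℝ} (hg : Measurable g)
    (hL2 : MemLp (fun ω => g (X 0 ω)) 2 P) {n : ℕ} (hn : 1 ≤ n) :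
    ∫ ω, 1 / (n : ℝ) * ∑ i ∈ Finset.range n, g (X i ω) ∂P = ∫ ω, g (X 0 ω) ∂P := by
  have hi (i : ℕ) : ∫ ω, g (X i ω) ∂P = ∫ ω, g (X 0 ω) ∂P := ((hident i).comp hg).integral_eq
  rw [integral_const_mul, integral_finsetSum _ fun i _ =>
    (memLp_comp_sample hident hg hL2 i).integrable one_le_two]
  simp only [hi, Finset.sum_const, Finset.card_range, nsmul_eq_mul]
  field_simp

variable {θhat : 𝒳 → T → ℝ} {θ : T → ℝ}

/-- The canonical distances of the centred sample means shrink like `1 / √n`. -/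
theorem canonicalDist_centred_sq (hmeas : ∀ t, Measurable fun x => θhat x t)
    (hindep : iIndepFun X P) (hident : ∀ i, IdentDistrib (X i) (X 0) P P)
    (hvar : ∀ t, MemLp (fun ω => θhat (X 0 ω) t) 2 P)
    (hθ : ∀ t, ∫ ω, θhat (X 0 ω) t ∂P = θ t) {n : ℕ} (hn : 1 ≤ n) (s t : T) :
    canonicalDist P (centred θhat X θ n) s t ^ 2 =
      Var[fun ω => θhat (X 0 ω) s - θhat (X 0 ω) t; P] / n := by
  have hg : Measurable fun x => θhat x s - θhat x t := (hmeas s).sub (hmeas t)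
  have hL2 : MemLp (fun ω => θhat (X 0 ω) s - θhat (X 0 ω) t) 2 P := (hvar s).sub (hvar t)
  have hint : ∫ ω, (θhat (X 0 ω) s - θhat (X 0 ω) t) ∂P = θ s - θ t := by
    rw [integral_sub ((hvar s).integrable one_le_two) ((hvar t).integrable one_le_two), hθ, hθ]
  rw [canonicalDist, Real.sq_sqrt (integral_nonneg fun ω => sq_nonneg _),
    ← variance_mean hindep hident hg hL2 hn,
    variance_eq_integral (memLp_mean hident hg hL2 n).aestronglyMeasurable.aemeasurable,
    integral_mean hident hg hL2 hn, hint]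
  simp only [centred_sub_centred]

/-- Scaling by `d_1` instead of `d_n` lets one admissible sequence serve every `n`, while the rate
`n / 2` grows. -/
theorem measure_centred_sub_centred_le (hmeas : ∀ t, Measurable fun x => θhat x t)
    (hindep : iIndepFun X P) (hident : ∀ i, IdentDistrib (X i) (X 0) P P)
    (hvar : ∀ t, MemLp (fun ω => θhat (X 0 ω) t) 2 P)
    (hθ : ∀ t, ∫ ω, θhat (X 0 ω) t ∂P = θ t) {n : ℕ} (hn : 1 ≤ n)
    (hsub : IsSubGaussian P (centred θhat X θ n)) (s t : T) {u : ℝ} (hu : 0 < u) :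
    P {ω | u * canonicalDist P (centred θhat X θ 1) s t <
        |centred θhat X θ n s ω - centred θhat X θ n t ω|} ≤
      ENNReal.ofReal (2 * Real.exp (-((n : ℝ) / 2 * u ^ 2))) := by
  have h1 := canonicalDist_centred_sq hmeas hindep hident hvar hθ le_rfl s t
  have hn' := canonicalDist_centred_sq hmeas hindep hident hvar hθ hn s t
  rw [Nat.cast_one, div_one] at h1
  rw [← h1] at hn'
  have hn0 : (n : ℝ) ≠ 0 := by positivity
  have hd0 : 0 ≤ canonicalDist P (centred θhat X θ 1) s t := Real.sqrt_nonneg _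
  -- If `d_1 = 0`, the threshold is 0 and `hsub` gives nothing; but `d_n = 0` as well, so the
  -- increment vanishes almost surely.
  rcases hd0.eq_or_lt' with h | h
  · have hmem : MemLp (fun ω => centred θhat X θ n s ω - centred θhat X θ n t ω) 2 P := by
      simp only [centred_sub_centred]
      exact (memLp_mean hident ((hmeas s).sub (hmeas t)) ((hvar s).sub (hvar t)) n).sub
        (memLp_const _)
    have hzero : ∫ ω, (centred θhat X θ n s ω - centred θhat X θ n t ω) ^ 2 ∂P = 0 := by
      rw [h, canonicalDist, Real.sq_sqrt (integral_nonneg fun ω => sq_nonneg _)] at hn'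
      simpa using hn'
    rw [integral_eq_zero_iff_of_nonneg (fun ω => sq_nonneg _) hmem.integrable_sq] at hzero
    refine le_trans (le_of_eq ?_) bot_le
    rw [h, mul_zero]
    refine measure_mono_null (fun ω hω => ?_) (ae_iff.1 hzero)
    simpa using hω
  · have hud := mul_pos hu h
    have hexp : (u * canonicalDist P (centred θhat X θ 1) s t) ^ 2 /
        (2 * canonicalDist P (centred θhat X θ n) s t ^ 2) = (n : ℝ) / 2 * u ^ 2 := by
      rw [hn']
      field_simp
    rw [← hexp]
    refine (measure_mono fun ω hω => ?_).trans
      ((ofReal_measureReal (measure_ne_top P _)).symm.le.trans (ENNReal.ofReal_le_ofReal (hsub s t _ hud)))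
    simp only [Set.mem_ofPred_eq] at hω ⊢
    exact hω.le

/-! ### Pointwise and uniform weak laws. -/

/-- The weak law of large numbers for the sample mean at a fixed parameter. -/
theorem tendsto_measure_lt_abs_centred (hmeas : ∀ t, Measurable fun x => θhat x t)
    (hindep : iIndepFun X P) (hident : ∀ i, IdentDistrib (X i) (X 0) P P)
    (hvar : ∀ t, MemLp (fun ω => θhat (X 0 ω) t) 2 P)
    (hθ : ∀ t, ∫ ω, θhat (X 0 ω) t ∂P = θ t) (t : T) {ε : ℝ} (hε : 0 < ε) :
    Tendsto (fun n => P {ω | ε < |centred θhat X θ n t ω|}) atTop (𝓝 0) := by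
  have hlim : Tendsto (fun n : ℕ => ENNReal.ofReal
      (Var[fun ω => θhat (X 0 ω) t; P] / ε ^ 2 / n)) atTop (𝓝 0) := by
    simpa using ENNReal.tendsto_ofReal
      (tendsto_const_div_atTop_nhds_zero_nat (Var[fun ω => θhat (X 0 ω) t; P] / ε ^ 2))
  refine tendsto_of_tendsto_of_tendsto_of_le_of_le' tendsto_const_nhds hlim
    (Eventually.of_forall fun _ => bot_le) ?_
  filter_upwards [eventually_ge_atTop 1] with n hn
  have h := meas_ge_le_variance_div_sq (memLp_mean hident (hmeas t) (hvar t) n) hε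
  rw [integral_mean hident (hmeas t) (hvar t) hn, hθ,
    variance_mean hindep hident (hmeas t) (hvar t) hn, div_right_comm] at h
  refine (measure_mono fun ω hω => ?_).trans h
  simp only [Set.mem_ofPred_eq] at hω ⊢
  exact hω.le

/-- Uniform weak law of large numbers over a countable set of finite Talagrand functional. -/
theorem tendsto_measure_exists_lt_abs_centred (hmeas : ∀ t, Measurable fun x => θhat x t)
    (hindep : iIndepFun X P) (hident : ∀ i, IdentDistrib (X i) (X 0) P P)
    (hvar : ∀ t, MemLp (fun ω => θhat (X 0 ω) t) 2 P)
    (hθ : ∀ t, ∫ ω, θhat (X 0 ω) t ∂P = θ t)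
    (hsub : ∀ n : ℕ, 1 ≤ n → IsSubGaussian P (centred θhat X θ n))
    {T' : Set T} (hT' : T'.Countable)
    (hγ : talagrand 2 T' (canonicalDist P (centred θhat X θ 1)) < ∞) {ε : ℝ} (hε : 0 < ε) :
    Tendsto (fun n => P {ω | ∃ t ∈ T', ε < |centred θhat X θ n t ω|}) atTop (𝓝 0) := by
  have := hT'.to_subtype
  rcases T'.eq_empty_or_nonempty with rfl | ⟨t₀, ht₀⟩
  · simp
  obtain ⟨𝒜, h⟩ := iInf_lt_iff.1 hγ
  obtain ⟨h𝒜, hfin⟩ := iInf_lt_iff.1 h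
  set M := ⨆ t : T', ∑' k : ℕ, (2 : ℝ≥0∞) ^ ((k : ℝ) / 2) *
    diameter (fun s t : T' => canonicalDist P (centred θhat X θ 1) s t) (cell 𝒜 k t) with hM
  obtain ⟨γ, hγ0, hMγ⟩ : ∃ γ : ℝ, 0 < γ ∧ M ≤ ENNReal.ofReal γ := by
    -- The added 1 keeps `γ` positive even if `M = 0`, as the division defining `u` requires.
    refine ⟨M.toReal + 1, by positivity, ?_⟩
    rw [ENNReal.le_ofReal_iff_toReal_le hfin.ne (by positivity)]
    linarith
  -- Half of `ε` goes to the chaining bound `2uγ`, the other half to the root.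
  set u := ε / (4 * γ) with hu_def
  have hu : 0 < u := by positivity
  have huγ : 2 * (u * γ) = ε / 2 := by
    rw [hu_def]
    field_simp
    norm_num
  set r : T := (classRep (𝒜 0) (⟨t₀, ht₀⟩ : T')).1
  have hexp : Tendsto (fun n : ℕ => Real.exp (-((n : ℝ) / 2 * u ^ 2))) atTop (𝓝 0) := by
    refine Real.tendsto_exp_neg_atTop_nhds_zero.comp ?_
    exact (tendsto_natCast_atTop_atTop.atTop_div_const two_pos).atTop_mul_const (by positivity)
  have hlim : Tendsto (fun n : ℕ => ENNReal.ofReal (16 * Real.exp (-((n : ℝ) / 2 * u ^ 2))) +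
      P {ω | ε / 2 < |centred θhat X θ n r ω|}) atTop (𝓝 0) := by
    have h1 := ENNReal.tendsto_ofReal (hexp.const_mul 16)
    rw [mul_zero, ENNReal.ofReal_zero] at h1
    simpa using h1.add
      (tendsto_measure_lt_abs_centred hmeas hindep hident hvar hθ r (half_pos hε))
  refine tendsto_of_tendsto_of_tendsto_of_le_of_le' tendsto_const_nhds hlim
    (Eventually.of_forall fun _ => bot_le) ?_
  filter_upwards [eventually_ge_atTop 1, hexp.eventually_lt_const (u := 1 / 8) (by norm_num)]
    with n hn hsmall
  have hchain := measure_chaining_le (P := P) (S := T')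
    (Z := fun t : T' => centred θhat X θ n t)
    (d := fun s t : T' => canonicalDist P (centred θhat X θ 1) s t)
    (fun s t => Real.sqrt_nonneg _) (c := (n : ℝ) / 2)
    (fun s t v hv => measure_centred_sub_centred_le hmeas hindep hident hvar hθ hn (hsub n hn)
      s t hv) h𝒜 hγ0.le (fun t => (le_iSup _ t).trans hMγ) hu (by linarith) ⟨t₀, ht₀⟩
  rw [huγ] at hchain
  refine (measure_mono ?_).trans ((measure_union_le _ _).trans (add_le_add_left hchain _))
  rintro ω ⟨t, ht, hω⟩
  by_cases hr : ε / 2 < |centred θhat X θ n r ω|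
  · exact Or.inr hr
  · refine Or.inl ⟨⟨t, ht⟩, ?_⟩
    change ε / 2 < |centred θhat X θ n t ω - centred θhat X θ n r ω|
    have := abs_sub_abs_le_abs_sub (centred θhat X θ n t ω) (centred θhat X θ n r ω)
    linarith

end SampleMean

end ImpreciseEstimation

/-! ### Consistency of the lower envelope. -/

theorem mainTheorem5 {Ω : Type*} [MeasurableSpace Ω] (P : Measure Ω) [IsProbabilityMeasure P]
    {𝒳 : Type*} [MeasurableSpace 𝒳]
    -- the parameter set, a compact subset of `ℝ^m`
    {m : ℕ} (T : Set (EuclideanSpace ℝ (Fin m))) (hT : IsCompact T)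
    -- the estimator, measurable in `x` and continuous in `t`
    (θhat : 𝒳 → T → ℝ)
    (hmeas : ∀ t, Measurable fun x => θhat x t) (hcont : ∀ x, Continuous (θhat x))
    -- an i.i.d. sample
    (X : ℕ → Ω → 𝒳) (hX : ∀ i, Measurable (X i)) (hindep : iIndepFun X P)
    (hident : ∀ i, IdentDistrib (X i) (X 0) P P)
    -- finite variance and unbiasedness
    (hvar : ∀ t, MemLp (fun ω => θhat (X 0 ω) t) 2 P)
    (θ : T → ℝ) (hθ : ∀ t, ∫ ω, θhat (X 0 ω) t ∂P = θ t)
    -- `θ_*` is the minimum of `θ`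
    (θstar : ℝ) (hθstar : IsLeast (Set.range θ) θstar)
    -- `T'` is a countable dense subset of `T`
    (T' : Set T) (hT'count : T'.Countable) (hT'dense : Dense T')
    (hsub : ∀ n : ℕ, 1 ≤ n → IsSubGaussian P (centred θhat X θ n))
    (hσ : minStdDev P T' (centred θhat X θ 1) < ∞)
    (hγ : talagrand 2 T' (canonicalDist P (centred θhat X θ 1)) < ∞) :
    IsConsistent P (lowerEnvelope θhat X) θstar := by
  obtain ⟨⟨tmin, htmin⟩, hlb⟩ := hθstar
  have : CompactSpace T := isCompact_iff_compactSpace.1 hT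
  have : Nonempty T := ⟨tmin⟩
  intro ε hε
  have hlim := (tendsto_measure_exists_lt_abs_centred hmeas hindep hident hvar hθ hsub hT'count hγ
    (half_pos hε)).add (tendsto_measure_lt_abs_centred hmeas hindep hident hvar hθ tmin hε)
  rw [add_zero] at hlim
  refine tendsto_of_tendsto_of_tendsto_of_le_of_le tendsto_const_nhds hlim (fun _ => bot_le)
    fun n => (measure_mono fun ω hω => ?_).trans (measure_union_le _ _)
  obtain ⟨⟨t, ht⟩, hle⟩ := isLeast_lowerEnvelope θhat hcont X n ω
  have hmin := hle (Set.mem_range_self tmin)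
  by_contra hnot
  simp only [Set.mem_union, Set.mem_ofPred_eq, not_or, not_exists, not_and, not_lt] at hnot
  rw [Set.mem_ofPred_eq, lt_abs] at hω
  obtain ⟨hunif, hpoint⟩ := hnot
  have hc : Continuous fun s => sampleMean θhat X n s ω :=
    continuous_const.mul (continuous_finsetSum _ fun i _ => hcont (X i ω))
  have hlower : θstar - ε / 2 ≤ lowerEnvelope θhat X n ω := by
    rw [← ht]
    refine hT'dense.induction (P := fun s => θstar - ε / 2 ≤ sampleMean θhat X n s ω)
      (fun s hs => ?_) (isClosed_le continuous_const hc) t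
    have h1 := (abs_le.1 (hunif s hs)).1
    have h2 := hlb (Set.mem_range_self s)
    unfold centred at h1
    linarith
  have hupper : lowerEnvelope θhat X n ω ≤ θstar + ε := by
    have h1 := (abs_le.1 hpoint).2
    unfold centred at h1
    linarith
  rcases hω with h | h <;> linarith
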